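/- Let $E$ be a (real) Banach lattice. Expressions $f(x,y)\in E$, for $x,y\in E$ and $f:\mathbb{R}^2\to\mathbb{R}$ continuous and positively homogeneous of degree one, are understood in the sense of the Krivine functional calculus: $f\mapsto f(x,y)$ is the unique linear lattice homomorphism that sends the two coordinate functions to $x$ and $y$. For real $t$ and $r>0$, $t^r$ denotes the signed power $\operatorname{sign}(t)|t|^r$. $E$ is called uniformly monotone if, for some $1\le p<\infty$, for every $\epsilon>0$, $$\inf\{\,\|(|x|^p+|y|^p)^{1/p}\|-1 : x,y\in E,\ \|x\|=1,\ \|y\|\ge\epsilon\,\}>0 .$$ For $1<p<\infty$, the $p$-convexification $E^{(p)}$ is the set $E$ with the addition $x\oplus y=(x^{1/p}+y^{1/p})^p$, the scalar multiplication $c\odot x=c^p x$ and the norm $\|x\|_{E^{(p)}}=\|x\|_E^{1/p}$. A Banach space $X$ is called uniformly convex if for every $\epsilon>0$ there is $\delta>0$ such that $\max\{\|x+y\|,\|x-y\|\}\ge 1+\delta$ for all $x,y\in X$ with $\|x\|=1$ and $\|y\|\ge\epsilon$. Then the following statements are equivalent: 1. $E$ is uniformly monotone. 2. $E^{(p)}$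 is uniformly convex for all $1<p<\infty$. 3. $E^{(p)}$ is uniformly convex for some $1<p<\infty$. -/

import Mathlib

noncomputable section

namespace BanachLattice

/-! ### The Krivine functional calculus -/

/-- The space `H_n` of continuous functions `f : ℝⁿ → ℝ` which are positively homogeneous of
degree one, `f (t s) = t f (s)` for `t ≥ 0`. -/
def PosHom (n : ℕ) : Submodule ℝ ((Fin n → ℝ) → ℝ) where
  carrier := {f | Continuous f ∧ ∀ t : ℝ, 0 ≤ t → ∀ s, f (t • s) = t * f s}
  add_mem' := by
    rintro f g ⟨hf, hf'⟩ ⟨hg, hg'⟩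
    refine ⟨hf.add hg, fun t ht s => ?_⟩
    simp only [Pi.add_apply, hf' t ht s, hg' t ht s]
    ring
  zero_mem' := ⟨continuous_const, fun t _ s => by simp⟩
  smul_mem' := by
    rintro c f ⟨hf, hf'⟩
    refine ⟨continuous_const.mul hf, fun t ht s => ?_⟩
    simp only [Pi.smul_apply, smul_eq_mul, hf' t ht s]
    ring

/-- The `i`-th coordinate function, as an element of `H_n`. -/
def PosHom.coord {n : ℕ} (i : Fin n) : PosHom n :=
  ⟨fun s => s i, continuous_apply i, fun t _ s => by simp⟩

/-- `H_n` is closed under pointwise maxima. -/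
theorem PosHom.sup_mem {n : ℕ} (f g : PosHom n) :
    (f : (Fin n → ℝ) → ℝ) ⊔ (g : (Fin n → ℝ) → ℝ) ∈ PosHom n := by
  obtain ⟨f, hf, hf'⟩ := f
  obtain ⟨g, hg, hg'⟩ := g
  refine ⟨hf.sup hg, fun t ht s => ?_⟩
  simp only [Pi.sup_apply, hf' t ht s, hg' t ht s]
  exact (mul_max_of_nonneg _ _ ht).symm

/-- `τ : H_n → E` is a linear lattice homomorphism sending the `i`-th coordinate function to `x i`
for every `i`.  (A linear map which preserves binary suprema also preserves infima.) -/
structure IsKrivineCalculus {E : Type*} [AddCommGroup E] [Module ℝ E] [Lattice E] {n : ℕ}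
    (x : Fin n → E) (τ : PosHom n →ₗ[ℝ] E) : Prop where
  map_coord : ∀ i, τ (PosHom.coord i) = x i
  map_sup : ∀ f g : PosHom n, τ ⟨_, PosHom.sup_mem f g⟩ = τ f ⊔ τ g

open Classical in
/-- The Krivine functional calculus: the element `f (x₁, …, xₙ)` of `E`, for `f ∈ H_n`, is the
value at `f` of the lattice homomorphism `τ : H_n → E` with `τ (coord i) = x i`.  In a Banach
lattice there is exactly one such `τ`, for every choice of `x₁, …, xₙ`. -/
def krivine {E : Type*} [AddCommGroup E] [Module ℝ E] [Lattice E] {n : ℕ}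
    (x : Fin n → E) (f : PosHom n) : E :=
  if h : ∃ τ : PosHom n →ₗ[ℝ] E, IsKrivineCalculus x τ then h.choose f else 0

/-! ### The homogeneous functions that are used -/

/-- The signed power `t ↦ sign(t) |t|^r`. -/
def signedPow (r t : ℝ) : ℝ := (SignType.sign t : ℝ) * |t| ^ r

theorem signedPow_of_nonneg {r t : ℝ} (hr : 0 < r) (ht : 0 ≤ t) : signedPow r t = t ^ r := by
  rcases ht.eq_or_lt with rfl | ht
  · simp [signedPow, Real.zero_rpow hr.ne']
  · simp [signedPow, sign_pos ht, abs_of_pos ht]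

theorem signedPow_of_nonpos {r t : ℝ} (hr : 0 < r) (ht : t ≤ 0) :
    signedPow r t = -(-t) ^ r := by
  rcases ht.eq_or_lt with rfl | ht
  · simp [signedPow, Real.zero_rpow hr.ne']
  · simp [signedPow, sign_neg ht, abs_of_neg ht]

theorem continuous_signedPow {r : ℝ} (hr : 0 < r) : Continuous (signedPow r) := by
  have h : signedPow r = fun t => if 0 ≤ t then t ^ r else -(-t) ^ r := by
    funext t
    split_ifs with ht
    · exact signedPow_of_nonneg hr ht
    · exact signedPow_of_nonpos hr (not_le.mp ht).le
  rw [h]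
  refine Continuous.if_le (Real.continuous_rpow_const hr.le)
    ((Real.continuous_rpow_const hr.le).comp continuous_neg).neg continuous_const continuous_id ?_
  rintro t rfl
  simp [Real.zero_rpow hr.ne']

theorem signedPow_mul {r t : ℝ} (hr : 0 < r) (ht : 0 ≤ t) (s : ℝ) :
    signedPow r (t * s) = t ^ r * signedPow r s := by
  rcases le_total 0 s with hs | hs
  · rw [signedPow_of_nonneg hr (mul_nonneg ht hs), signedPow_of_nonneg hr hs,
      Real.mul_rpow ht hs]
  · rw [signedPow_of_nonpos hr (mul_nonpos_of_nonneg_of_nonpos ht hs), signedPow_of_nonpos hr hs,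
      ← mul_neg, Real.mul_rpow ht (neg_nonneg.mpr hs), mul_neg]

/-- The function `(s₀, s₁) ↦ (|s₀|^p + |s₁|^p)^{1/p}`, as an element of `H_2`. -/
def lpSum (p : ℝ) (hp : 0 < p) : PosHom 2 :=
  ⟨fun s => (|s 0| ^ p + |s 1| ^ p) ^ (1 / p), by
    refine ⟨?_, fun t ht s => ?_⟩
    · have h := Real.continuous_rpow_const hp.le
      have h' := Real.continuous_rpow_const (one_div_pos.mpr hp).le
      exact h'.comp ((h.comp (continuous_apply 0).abs).add (h.comp (continuous_apply 1).abs))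
    · have h0 : 0 ≤ |s 0| ^ p + |s 1| ^ p := by positivity
      simp only [Pi.smul_apply, smul_eq_mul, abs_mul, abs_of_nonneg ht,
        Real.mul_rpow ht (abs_nonneg _)]
      rw [← mul_add, Real.mul_rpow (Real.rpow_nonneg ht p) h0, ← Real.rpow_mul ht,
        mul_one_div_cancel hp.ne', Real.rpow_one]⟩

/-- The function `(s₀, s₁) ↦ (s₀^{1/p} + s₁^{1/p})^p`, with signed powers, as an element of
`H_2`. -/
def powerSum (p : ℝ) (hp : 0 < p) : PosHom 2 :=
  ⟨fun s => signedPow p (signedPow (1 / p) (s 0) + signedPow (1 / p) (s 1)), by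
    refine ⟨?_, fun t ht s => ?_⟩
    · have h := continuous_signedPow hp
      have h' := continuous_signedPow (one_div_pos.mpr hp)
      exact h.comp ((h'.comp (continuous_apply 0)).add (h'.comp (continuous_apply 1)))
    · simp only [Pi.smul_apply, smul_eq_mul, signedPow_mul (one_div_pos.mpr hp) ht]
      rw [← mul_add, signedPow_mul hp (Real.rpow_nonneg ht _), ← Real.rpow_mul ht,
        one_div_mul_cancel hp.ne', Real.rpow_one]⟩

/-! ### Uniform monotonicity -/

/-- A Banach lattice `E` is uniformly monotone if for some `1 ≤ p < ∞` and every `ε > 0`,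
`inf {‖(|x|^p + |y|^p)^{1/p}‖ - 1 : ‖y‖ ≥ ε, ‖x‖ = 1} > 0`. -/
def UniformlyMonotone (E : Type*) [NormedAddCommGroup E] [NormedSpace ℝ E] [Lattice E] : Prop :=
  ∃ (p : ℝ) (hp : 1 ≤ p), ∀ ε : ℝ, 0 < ε → ∃ δ : ℝ, 0 < δ ∧ ∀ x y : E, ‖x‖ = 1 → ε ≤ ‖y‖ →
    δ ≤ ‖krivine ![x, y] (lpSum p (zero_lt_one.trans_le hp))‖ - 1

/-! ### The `p`-convexification -/

/-- The `p`-convexification `E^{(p)}` of a Banach lattice `E`, for `1 < p < ∞`: the set `E` with the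
operations and the norm that are given below. -/
@[ext]
structure PConvexification (E : Type*) (p : ℝ) (hp : 1 < p) where
  /-- The underlying element of `E`. -/
  val : E

namespace PConvexification

variable {E : Type*} [NormedAddCommGroup E] [NormedSpace ℝ E] [Lattice E] {p : ℝ} {hp : 1 < p}

/-- `x ⊕ y = (x^{1/p} + y^{1/p})^p`. -/
instance : Add (PConvexification E p hp) :=
  ⟨fun x y => ⟨krivine ![x.val, y.val] (powerSum p (zero_lt_one.trans hp))⟩⟩

/-- `c ⊙ x = c^p x`, where `c^p = -|c|^p` for `c < 0`. -/
instance : SMul ℝ (PConvexification E p hp) := ⟨fun c x => ⟨signedPow p c • x.val⟩⟩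

/-- The difference `x ⊕ ((-1) ⊙ y)`. -/
instance : Sub (PConvexification E p hp) := ⟨fun x y => x + (-1 : ℝ) • y⟩

/-- The norm of `x` in `E^{(p)}` is `‖x‖^{1/p}`. -/
instance : Norm (PConvexification E p hp) := ⟨fun x => ‖x.val‖ ^ (1 / p)⟩

end PConvexification

/-! ### Uniform convexity -/

/-- `X` is uniformly convex if for every `ε > 0` there is `δ > 0` with
`inf {max (‖x + y‖, ‖x - y‖) : ‖y‖ ≥ ε, ‖x‖ = 1} ≥ 1 + δ`. -/
def UniformlyConvex (X : Type*) [Add X] [Sub X] [Norm X] : Prop :=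
  ∀ ε : ℝ, 0 < ε → ∃ δ : ℝ, 0 < δ ∧ ∀ x y : X, ‖x‖ = 1 → ε ≤ ‖y‖ →
    1 + δ ≤ max ‖x + y‖ ‖x - y‖

end BanachLattice

end

/-! The Krivine calculus turns inequalities between functions on `ℝ²` into inequalities in `E`. The
exponent in uniform monotonicity is irrelevant: `(|x|^p + |y|^p)^{1/p} ≤ |x| + |y|`, and `p = 1` is
allowed, so the condition says that `‖|x| + |y|‖` exceeds `1` uniformly (`uniformlyMonotone_iff`).

Monotone implies convex: let `A` and `B` be the sum and difference of `x`, `y` in `E^{(q)}`.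
Convexity of `|t|^q` gives `F = (|A| + |B|)/2 - |x| ≥ 0`, and by strict convexity `F` vanishes only
where `y` does. Compactness of the sphere (`PosHom.exists_mul_le`) bounds `‖F‖` below, so `‖|A| +
|B|‖/2 = ‖|x| + F‖ ≥ 1 + δ`, and one of `A`, `B` is large.

Convex implies monotone: let `S = |x| + |y|` and `A = |x|`, with midpoint `u` and half-difference
`v` in `E^{(q)}`, so that `S = u ⊕ v` and `A = u ⊖ v`. Then `A ≤ u ≤ S`, and `v` is bounded below in
norm by the same compactness argument. Uniform convexity, applied to `u` and `v` after normalising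
`u`, keeps `‖S‖` away from `1`.

The calculus itself has to be constructed. In the ideal generated by `|x 0| ⊔ |x 1|` the real
lattice homomorphisms determine the order (`nonpos_of_forall_latticeHom`), so `f(x)` is
characterised by its values under them. It exists for a dense set of `f` trivially, and for all `f`
by completeness. -/

namespace BanachLattice

open Set

/-! ### Lattice homomorphisms on a vector lattice with an order unit -/

/-- Two indices that nearly attain the separate infima have a common index that is at least as good
for both. This is what lets maxima survive the infima taken below. -/
theorem ciInf_max_of_directed {ι : Type*} [Nonempty ι] {f g : ι → ℝ}
    (hf : BddBelow (range f)) (hg : BddBelow (range g))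
    (h : ∀ i j, ∃ k, f k ≤ f i ∧ g k ≤ g j) :
    ⨅ i, max (f i) (g i) = max (⨅ i, f i) (⨅ i, g i) := by
  have hb : BddBelow (range fun i => max (f i) (g i)) := by
    obtain ⟨m, hm⟩ := hf
    refine ⟨m, ?_⟩
    rintro _ ⟨i, rfl⟩
    exact (hm ⟨i, rfl⟩).trans (le_max_left _ _)
  apply le_antisymm
  · by_contra! hlt
    obtain ⟨i, hi⟩ := exists_lt_of_ciInf_lt ((le_max_left _ _).trans_lt hlt)
    obtain ⟨j, hj⟩ := exists_lt_of_ciInf_lt ((le_max_right _ _).trans_lt hlt)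
    obtain ⟨k, hki, hkj⟩ := h i j
    exact absurd (ciInf_le hb k) (not_le.2 (max_lt (hki.trans_lt hi) (hkj.trans_lt hj)))
  · exact max_le (ciInf_mono hf fun i => le_max_left _ _)
      (ciInf_mono hg fun i => le_max_right _ _)

section Separation

variable {V : Type*} [AddCommGroup V] [Module ℝ V] [Lattice V]

/-- A sublinear functional which preserves binary suprema. -/
structure IsMaxSublinear (p : V → ℝ) : Prop where
  add_le : ∀ a b, p (a + b) ≤ p a + p b
  smul_le : ∀ c : ℝ, 0 < c → ∀ a, p (c • a) ≤ c * p a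
  map_sup : ∀ a b, p (a ⊔ b) = max (p a) (p b)

namespace IsMaxSublinear

variable {p : V → ℝ}

theorem map_zero (hp : IsMaxSublinear p) : p 0 = 0 := by
  have h1 := hp.smul_le 2 (by norm_num) 0
  have h2 := hp.smul_le (1 / 2) (by norm_num) 0
  rw [smul_zero] at h1 h2
  linarith

theorem map_smul (hp : IsMaxSublinear p) {c : ℝ} (hc : 0 ≤ c) (a : V) :
    p (c • a) = c * p a := by
  rcases hc.eq_or_lt with rfl | hc
  · simp [hp.map_zero]
  refine le_antisymm (hp.smul_le c hc a) ?_
  have h := hp.smul_le c⁻¹ (inv_pos.2 hc) (c • a)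
  rw [smul_smul, inv_mul_cancel₀ hc.ne', one_smul] at h
  calc c * p a ≤ c * (c⁻¹ * p (c • a)) := by gcongr
    _ = p (c • a) := by field_simp

theorem neg_le (hp : IsMaxSublinear p) (a : V) : -p (-a) ≤ p a := by
  have h := hp.add_le a (-a)
  rw [add_neg_cancel, hp.map_zero] at h
  linarith

theorem mono (hp : IsMaxSublinear p) {a b : V} (h : a ≤ b) : p a ≤ p b := by
  rw [← sup_eq_right.2 h, hp.map_sup]
  exact le_max_left _ _

/-- The largest sublinear functional below `p` which is linear in the direction `w`. -/
noncomputable def flatten (p : V → ℝ) (w a : V) : ℝ :=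
  ⨅ t : Ici (0 : ℝ), (p (a + (t : ℝ) • w) - t * p w)

theorem flatten_bddBelow (hp : IsMaxSublinear p) (w a : V) :
    BddBelow (range fun t : Ici (0 : ℝ) => p (a + (t : ℝ) • w) - t * p w) := by
  refine ⟨-p (-a), ?_⟩
  rintro _ ⟨⟨t, ht⟩, rfl⟩
  have h := hp.add_le (a + t • w) (-a)
  rw [add_neg_cancel_comm, hp.map_smul ht] at h
  dsimp only
  linarith

theorem flatten_le (hp : IsMaxSublinear p) (w a : V) {t : ℝ} (ht : 0 ≤ t) :
    flatten p w a ≤ p (a + t • w) - t * p w :=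
  ciInf_le (hp.flatten_bddBelow w a) ⟨t, ht⟩

theorem flatten_le_self (hp : IsMaxSublinear p) (w a : V) : flatten p w a ≤ p a := by
  simpa using hp.flatten_le w a le_rfl

theorem flatten_neg (hp : IsMaxSublinear p) (w : V) : flatten p w (-w) ≤ -p w := by
  simpa [hp.map_zero] using hp.flatten_le w (-w) zero_le_one

theorem flatten_antitone (hp : IsMaxSublinear p) (w a : V) {s t : ℝ} (hst : s ≤ t) :
    p (a + t • w) - t * p w ≤ p (a + s • w) - s * p w := by
  have h := hp.add_le (a + s • w) ((t - s) • w)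
  rw [hp.map_smul (sub_nonneg.2 hst), add_assoc, ← add_smul, add_sub_cancel] at h
  linarith

/-- The expression under the infimum decreases in `t` (`flatten_antitone`), so a larger `t` serves
two arguments at once and the infimum commutes with maxima. -/
theorem isMaxSublinear_flatten [IsOrderedAddMonoid V] (hp : IsMaxSublinear p) (w : V) :
    IsMaxSublinear (flatten p w) where
  add_le a b := by
    refine le_ciInf_add_ciInf ?_
    rintro ⟨s, hs⟩ ⟨t, ht⟩
    have h1 := hp.flatten_le w (a + b) (add_nonneg hs ht)
    have h2 := hp.add_le (a + s • w) (b + t • w)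
    rw [add_smul, add_add_add_comm] at h1
    dsimp only
    linarith
  smul_le c hc a := by
    unfold flatten
    rw [Real.mul_iInf_of_nonneg hc.le]
    refine le_ciInf ?_
    rintro ⟨t, ht⟩
    refine (hp.flatten_le w (c • a) (mul_nonneg hc.le ht)).trans (le_of_eq ?_)
    rw [mul_smul, ← smul_add, hp.map_smul hc.le]
    ring
  map_sup a b := by
    unfold flatten
    rw [← ciInf_max_of_directed (hp.flatten_bddBelow w a) (hp.flatten_bddBelow w b)]
    · refine iInf_congr fun t => ?_
      rw [sup_add, hp.map_sup, max_sub_sub_right]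
    · rintro ⟨s, hs⟩ ⟨t, ht⟩
      exact ⟨⟨max s t, (mem_Ici.1 hs).trans (le_max_left s t)⟩, hp.flatten_antitone w a (le_max_left s t),
        hp.flatten_antitone w b (le_max_right s t)⟩

theorem isMaxSublinear_iInf_chain {C : Set (V → ℝ)} (hC : ∀ q ∈ C, IsMaxSublinear q)
    (hchain : IsChain (· ≤ ·) C) (hne : C.Nonempty)
    (hb : ∀ a, BddBelow (range fun q : C => (q : V → ℝ) a)) :
    IsMaxSublinear fun a => ⨅ q : C, (q : V → ℝ) a := by
  have : Nonempty C := hne.to_subtype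
  have hdir : ∀ q r : C, ∃ k : C, (k : V → ℝ) ≤ q ∧ (k : V → ℝ) ≤ r := by
    intro q r
    rcases hchain.total q.2 r.2 with h | h
    · exact ⟨q, le_rfl, h⟩
    · exact ⟨r, h, le_rfl⟩
  refine ⟨fun a b => ?_, fun c hc a => ?_, fun a b => ?_⟩
  · refine le_ciInf_add_ciInf fun q r => ?_
    obtain ⟨k, hkq, hkr⟩ := hdir q r
    exact (ciInf_le (hb (a + b)) k).trans
      (((hC k k.2).add_le a b).trans (add_le_add (hkq a) (hkr b)))
  · rw [Real.mul_iInf_of_nonneg hc.le]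
    exact ciInf_mono (hb _) fun q => (hC q q.2).smul_le c hc a
  · rw [← ciInf_max_of_directed (hb a) (hb b)]
    · exact iInf_congr fun q => (hC q q.2).map_sup a b
    · intro q r
      obtain ⟨k, hkq, hkr⟩ := hdir q r
      exact ⟨k, hkq a, hkr b⟩

/-- Below every supremum preserving sublinear functional there is a linear one. -/
theorem exists_linearMap_le [IsOrderedAddMonoid V] (hp : IsMaxSublinear p) :
    ∃ φ : V →ₗ[ℝ] ℝ, (∀ a b, φ (a ⊔ b) = φ a ⊔ φ b) ∧ ∀ a, φ a ≤ p a := by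
  let S : Set (V → ℝ)ᵒᵈ := {q | IsMaxSublinear (OrderDual.ofDual q) ∧ OrderDual.ofDual q ≤ p}
  obtain ⟨m, -, ⟨hm, hmp⟩, hmin⟩ := zorn_le_nonempty₀ S (by
    intro C hCS hC q₀ hq₀
    have hb : ∀ a, BddBelow (range fun q : (OrderDual.toDual ⁻¹' C : Set (V → ℝ)) =>
        (q : V → ℝ) a) := by
      intro a
      -- Since `q ≤ p`, sublinearity gives `-p (-a) ≤ -q (-a) ≤ q a`, a bound common to the whole
      -- chain.
      refine ⟨-p (-a), ?_⟩
      rintro _ ⟨⟨q, hq⟩, rfl⟩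
      exact (neg_le_neg ((hCS hq).2 (-a))).trans ((hCS hq).1.neg_le a)
    refine ⟨OrderDual.toDual fun a => ⨅ q : (OrderDual.toDual ⁻¹' C : Set (V → ℝ)),
      (q : V → ℝ) a, ⟨?_, ?_⟩, ?_⟩
    · refine isMaxSublinear_iInf_chain (fun q hq => (hCS hq).1) ?_ ⟨OrderDual.ofDual q₀, hq₀⟩ hb
      intro q hq r hr hqr
      exact (hC hq hr hqr).symm
    · intro a
      exact (ciInf_le (hb a) ⟨OrderDual.ofDual q₀, hq₀⟩).trans ((hCS hq₀).2 a)
    · intro q hq a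
      exact ciInf_le (hb a) ⟨OrderDual.ofDual q, hq⟩) (OrderDual.toDual p) ⟨hp, le_rfl⟩
  set q : V → ℝ := OrderDual.ofDual m
  -- By minimality, flattening in any direction changes nothing; hence `q` is odd, and an odd
  -- sublinear functional is linear.
  have hle : ∀ w, q ≤ flatten q w := fun w =>
    hmin (y := OrderDual.toDual (flatten q w))
      ⟨hm.isMaxSublinear_flatten w, fun a => (hm.flatten_le_self w a).trans (hmp a)⟩
      (fun a => hm.flatten_le_self w a)
  have hneg : ∀ w, q (-w) = -q w := fun w =>
    le_antisymm ((hle w (-w)).trans (hm.flatten_neg w)) (by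
      have := hm.neg_le w
      linarith)
  refine ⟨{ toFun := q, map_add' := fun a b => ?_, map_smul' := fun c a => ?_ },
    hm.map_sup, hmp⟩
  · refine le_antisymm (hm.add_le a b) ?_
    have h := hm.add_le (-a) (-b)
    rw [← neg_add, hneg, hneg, hneg] at h
    linarith
  · rcases le_total 0 c with hc | hc
    · exact hm.map_smul hc a
    · have h := hm.map_smul (neg_nonneg.2 hc) a
      rw [neg_smul, hneg] at h
      simp only [RingHom.id_apply, smul_eq_mul]
      linarith

end IsMaxSublinear

variable [IsOrderedAddMonoid V] [IsOrderedModule ℝ V]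

/-- In an Archimedean vector lattice with an order unit, the real-valued lattice homomorphisms
determine the order. -/
theorem nonpos_of_forall_latticeHom {u : V} (hu : 0 ≤ u) (hunit : ∀ a : V, ∃ M : ℝ, a ≤ M • u)
    (harch : ∀ a : V, (∀ ε : ℝ, 0 < ε → a ≤ ε • u) → a ≤ 0) {a : V}
    (ha : ∀ φ : V →ₗ[ℝ] ℝ, (∀ b c, φ (b ⊔ c) = φ b ⊔ φ c) → φ a ≤ 0) : a ≤ 0 := by
  by_contra hna
  -- The one-sided gauge of the order unit; the Archimedean property gives `a ≤ 0` as soon as `p a ≤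
  -- 0`.
  let p : V → ℝ := fun b => sInf {M : ℝ | b ≤ M • u}
  have hu' : ¬ u ≤ 0 := by
    intro h
    obtain ⟨M, hM⟩ := hunit a
    rw [le_antisymm h hu, smul_zero] at hM
    exact hna hM
  have hmono : ∀ {b : V} {M N : ℝ}, b ≤ M • u → M ≤ N → b ≤ N • u := fun h hMN =>
    h.trans (smul_le_smul_of_nonneg_right hMN hu)
  have hbdd : ∀ b : V, BddBelow {M : ℝ | b ≤ M • u} := by
    intro b
    obtain ⟨M', hM'⟩ := hunit (-b)
    refine ⟨-M', fun M hM => ?_⟩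
    by_contra! hlt
    have h : 0 ≤ (M + M') • u := by
      have := add_le_add hM hM'
      rwa [add_neg_cancel, ← add_smul] at this
    have hpos : 0 < -(M + M') := by linarith
    have h' : (-(M + M')) • u ≤ 0 := by
      rw [neg_smul]
      exact neg_nonpos.2 h
    have h2 := smul_le_smul_of_nonneg_left h' (inv_pos.2 hpos).le
    rw [smul_smul, inv_mul_cancel₀ hpos.ne', one_smul, smul_zero] at h2
    exact hu' h2
  have hle : ∀ {b : V} {M : ℝ}, b ≤ M • u → p b ≤ M := fun h => csInf_le (hbdd _) h
  have hlt : ∀ {b : V} {M : ℝ}, p b < M → b ≤ M • u := by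
    intro b M h
    obtain ⟨N, hN, hNM⟩ := exists_lt_of_csInf_lt (hunit b) h
    exact hmono hN hNM.le
  have hp : IsMaxSublinear p := by
    refine ⟨fun b c => ?_, fun r hr b => ?_, fun b c => ?_⟩
    · refine le_of_forall_pos_le_add fun ε hε => ?_
      have h := add_le_add (hlt (show p b < p b + ε / 2 by linarith))
        (hlt (show p c < p c + ε / 2 by linarith))
      rw [← add_smul] at h
      linarith [hle h]
    · rw [← sub_nonpos]
      refine le_of_forall_pos_le_add fun ε hε => ?_
      have h := smul_le_smul_of_nonneg_left
        (hlt (show p b < p b + ε / r by linarith [div_pos hε hr])) hr.le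
      rw [smul_smul] at h
      have h' := hle h
      rw [mul_add, mul_div_cancel₀ _ hr.ne'] at h'
      linarith
    · apply le_antisymm
      · refine le_of_forall_pos_le_add fun ε hε => hle (sup_le (hlt ?_) (hlt ?_))
        · linarith [le_max_left (p b) (p c)]
        · linarith [le_max_right (p b) (p c)]
      · refine le_of_forall_pos_le_add fun ε hε => ?_
        have h := hlt (show p (b ⊔ c) < p (b ⊔ c) + ε by linarith)
        exact max_le (hle (le_sup_left.trans h)) (hle (le_sup_right.trans h))
  -- Flattening along `a` first forces `φ (-a) ≤ -p a`, that is, `p a ≤ φ a`.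
  obtain ⟨φ, hφ, hφp⟩ := (hp.isMaxSublinear_flatten a).exists_linearMap_le
  have h1 := (hφp (-a)).trans (hp.flatten_neg a)
  rw [_root_.map_neg] at h1
  have h2 := ha φ hφ
  exact hna (harch a fun ε hε => hlt (by linarith))

end Separation

end BanachLattice

namespace BanachLattice

open Set

/-! ### Density of vector sublattices of `H_2` -/

theorem PosHom.map_smul_of_nonneg {n : ℕ} (f : PosHom n) {t : ℝ} (ht : 0 ≤ t) (s : Fin n → ℝ) :
    f.1 (t • s) = t * f.1 s :=
  f.2.2 t ht s

theorem PosHom.continuous {n : ℕ} (f : PosHom n) : Continuous f.1 := f.2.1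

theorem PosHom.map_zero {n : ℕ} (f : PosHom n) : f.1 0 = 0 := by
  simpa using PosHom.map_smul_of_nonneg f le_rfl 0

/-- A bound on the unit sphere extends by homogeneity. -/
theorem PosHom.le_of_sphere {n : ℕ} {f g : PosHom n}
    (h : ∀ s ∈ Metric.sphere (0 : Fin n → ℝ) 1, f.1 s ≤ g.1 s) (s : Fin n → ℝ) :
    f.1 s ≤ g.1 s := by
  rcases eq_or_ne s 0 with rfl | hs
  · rw [PosHom.map_zero f, PosHom.map_zero g]
  have hs' : 0 < ‖s‖ := norm_pos_iff.2 hs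
  have hmem : ‖s‖⁻¹ • s ∈ Metric.sphere (0 : Fin n → ℝ) 1 := by
    rw [mem_sphere_zero_iff_norm, norm_smul, norm_inv, norm_norm, inv_mul_cancel₀ hs'.ne']
  have h1 := h _ hmem
  rw [PosHom.map_smul_of_nonneg f (inv_nonneg.2 hs'.le), PosHom.map_smul_of_nonneg g (inv_nonneg.2 hs'.le)] at h1
  exact le_of_mul_le_mul_left h1 (inv_pos.2 hs')

/-- The norm, as an element of `H_n`. -/
noncomputable def PosHom.norm (n : ℕ) : PosHom n :=
  ⟨fun s => ‖s‖, continuous_norm, fun t ht s => by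
    change ‖t • s‖ = t * ‖s‖
    rw [norm_smul, Real.norm_of_nonneg ht]⟩

theorem norm_fin_two (s : Fin 2 → ℝ) : ‖s‖ = max |s 0| |s 1| := by
  apply le_antisymm
  · rw [pi_norm_le_iff_of_nonneg (le_max_of_le_left (abs_nonneg _))]
    intro i
    fin_cases i
    · exact le_max_left _ _
    · exact le_max_right _ _
  · exact max_le (norm_le_pi_norm s 0) (norm_le_pi_norm s 1)

/-- On the unit sphere the norm is the constant `1`, so it supplies the constants needed for
two-point interpolation in the lattice form of Stone–Weierstrass. -/
theorem PosHom.norm_mem {D : Submodule ℝ (PosHom 2)}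
    (hsup : ∀ f ∈ D, ∀ g ∈ D, (⟨_, PosHom.sup_mem f g⟩ : PosHom 2) ∈ D)
    (hcoord : ∀ i, PosHom.coord i ∈ D) : PosHom.norm 2 ∈ D := by
  have habs : ∀ i, (⟨_, PosHom.sup_mem (PosHom.coord i) (-PosHom.coord i)⟩ : PosHom 2) ∈ D :=
    fun i => hsup _ (hcoord i) _ (D.neg_mem (hcoord i))
  convert hsup _ (habs 0) _ (habs 1) using 1
  ext s
  exact norm_fin_two s

/-- A vector sublattice of `H_2` that contains the coordinates is dense. -/
theorem PosHom.exists_mem_abs_sub_le {D : Submodule ℝ (PosHom 2)}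
    (hsup : ∀ f ∈ D, ∀ g ∈ D, (⟨_, PosHom.sup_mem f g⟩ : PosHom 2) ∈ D)
    (hcoord : ∀ i, PosHom.coord i ∈ D)
    (f : PosHom 2) {ε : ℝ} (hε : 0 < ε) :
    ∃ g ∈ D, ∀ s, |f.1 s - g.1 s| ≤ ε * ‖s‖ := by
  let X := Metric.sphere (0 : Fin 2 → ℝ) 1
  have : CompactSpace X := isCompact_iff_compactSpace.1 (isCompact_sphere 0 1)
  let r : PosHom 2 → C(X, ℝ) := fun g => ⟨fun s => g.1 s, (PosHom.continuous g).comp continuous_subtype_val⟩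
  have hN := PosHom.norm_mem hsup hcoord
  have hcl : closure (r '' D) = ⊤ := by
    refine ContinuousMap.sublattice_closure_eq_top _ ⟨_, 0, D.zero_mem, rfl⟩ ?_ ?_ ?_
    · rintro _ ⟨g, hg, rfl⟩ _ ⟨h, hh, rfl⟩
      refine ⟨-⟨_, PosHom.sup_mem (-g) (-h)⟩,
        D.neg_mem (hsup _ (D.neg_mem hg) _ (D.neg_mem hh)), ?_⟩
      ext s
      change -max (-g.1 s) (-h.1 s) = min (g.1 s) (h.1 s)
      rw [max_neg_neg, neg_neg]
    · rintro _ ⟨g, hg, rfl⟩ _ ⟨h, hh, rfl⟩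
      exact ⟨_, hsup _ hg _ hh, rfl⟩
    · intro v s t
      by_cases hst : s = t
      · subst hst
        refine ⟨_, ⟨v s • PosHom.norm 2, D.smul_mem _ hN, rfl⟩, ?_, ?_⟩ <;>
        · change v s * ‖(s : Fin 2 → ℝ)‖ = v s
          rw [mem_sphere_zero_iff_norm.1 s.2, mul_one]
      · obtain ⟨i, hi⟩ : ∃ i, (s : Fin 2 → ℝ) i ≠ (t : Fin 2 → ℝ) i := by
          by_contra! h
          exact hst (Subtype.ext (funext h))
        have hi' : (t : Fin 2 → ℝ) i - (s : Fin 2 → ℝ) i ≠ 0 := sub_ne_zero.2 hi.symm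
        let c := (v t - v s) / ((t : Fin 2 → ℝ) i - (s : Fin 2 → ℝ) i)
        refine ⟨_, ⟨(v s - c * (s : Fin 2 → ℝ) i) • PosHom.norm 2 + c • PosHom.coord i,
          D.add_mem (D.smul_mem _ hN) (D.smul_mem _ (hcoord i)), rfl⟩, ?_, ?_⟩
        · change (v s - c * (s : Fin 2 → ℝ) i) * ‖(s : Fin 2 → ℝ)‖ + c * (s : Fin 2 → ℝ) i = v s
          rw [mem_sphere_zero_iff_norm.1 s.2]
          ring
        · change (v s - c * (s : Fin 2 → ℝ) i) * ‖(t : Fin 2 → ℝ)‖ + c * (t : Fin 2 → ℝ) i = v t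
          rw [mem_sphere_zero_iff_norm.1 t.2]
          simp only [c]
          field_simp
          ring
  obtain ⟨_, ⟨g, hg, rfl⟩, hfg⟩ := Metric.mem_closure_iff.1
    (show r f ∈ closure (r '' D) by rw [hcl]; trivial) ε hε
  refine ⟨g, hg, fun s => ?_⟩
  have key : ∀ s ∈ X, |f.1 s - g.1 s| ≤ ε * ‖s‖ := by
    intro s hs
    rw [mem_sphere_zero_iff_norm.1 hs, mul_one]
    exact (ContinuousMap.dist_apply_le_dist (f := r f) (g := r g) ⟨s, hs⟩).trans hfg.le
  rw [abs_le']
  exact ⟨PosHom.le_of_sphere (f := f - g) (g := ε • PosHom.norm 2)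
    (fun s hs => (abs_le'.1 (key s hs)).1) s,
    PosHom.le_of_sphere (f := -(f - g)) (g := ε • PosHom.norm 2)
    (fun s hs => (abs_le'.1 (key s hs)).2) s⟩

/-- Comparison of homogeneous functions by compactness of the sphere. -/
theorem PosHom.exists_mul_le {n : ℕ} (F G : PosHom n) (hF : ∀ s, 0 ≤ F.1 s)
    (hFG : ∀ s, s ≠ 0 → F.1 s = 0 → G.1 s < 0) :
    ∃ c : ℝ, 0 < c ∧ ∀ s, c * G.1 s ≤ F.1 s := by
  -- Only points with `G ≥ 0` matter, and on this compact set `F` is strictly positive.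
  let K : Set (Fin n → ℝ) := Metric.sphere 0 1 ∩ {s | 0 ≤ G.1 s}
  have hK : IsCompact K :=
    (isCompact_sphere 0 1).inter_right (isClosed_le continuous_const (PosHom.continuous G))
  have hK0 : ∀ s ∈ K, 0 < F.1 s := by
    rintro s ⟨hs, hGs⟩
    refine (hF s).lt_of_ne fun h => ?_
    have hs0 : s ≠ 0 := by
      rintro rfl
      simp at hs
    exact absurd (hFG s hs0 h.symm) (not_lt.2 hGs)
  have main : ∃ c : ℝ, 0 < c ∧ ∀ s ∈ K, c * G.1 s ≤ F.1 s := by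
    rcases K.eq_empty_or_nonempty with h | h
    · exact ⟨1, one_pos, by simp [h]⟩
    · obtain ⟨a, ha, hmin⟩ := hK.exists_isMinOn h (PosHom.continuous F).continuousOn (s := K)
      obtain ⟨b, hb, hmax⟩ := hK.exists_isMaxOn h (PosHom.continuous G).continuousOn (s := K)
      -- The maximum of `G` on `K` may be `0`; adding `1` keeps the denominator positive.
      have hb0 : 0 < G.1 b + 1 := add_pos_of_nonneg_of_pos hb.2 one_pos
      refine ⟨F.1 a / (G.1 b + 1), div_pos (hK0 a ha) hb0, fun s hs => ?_⟩
      have h1 : F.1 a ≤ F.1 s := hmin hs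
      have h2 : G.1 s ≤ G.1 b := hmax hs
      refine le_trans ?_ h1
      rw [div_mul_eq_mul_div, div_le_iff₀ hb0]
      exact mul_le_mul_of_nonneg_left (by linarith) (hF a)
  obtain ⟨c, hc, h⟩ := main
  refine ⟨c, hc, PosHom.le_of_sphere (f := c • G) (g := F) fun s hs => ?_⟩
  change c * G.1 s ≤ F.1 s
  rcases le_total 0 (G.1 s) with hG | hG
  · exact h s ⟨hs, hG⟩
  · exact (mul_nonpos_of_nonneg_of_nonpos hc.le hG).trans (hF s)

end BanachLattice

namespace BanachLattice

open Set Filter Topology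

/-! ### Principal ideals -/

section Ideal

variable {E : Type*} [AddCommGroup E] [Module ℝ E] [Lattice E] [IsOrderedAddMonoid E]
  [IsOrderedModule ℝ E]

/-- The ideal generated by an element of a vector lattice. -/
def principalIdeal (u : E) : Submodule ℝ E where
  carrier := {e | ∃ M : ℝ, e ≤ M • |u| ∧ -e ≤ M • |u|}
  add_mem' := by
    rintro a b ⟨M, h1, h2⟩ ⟨N, h3, h4⟩
    refine ⟨M + N, ?_, ?_⟩
    · rw [add_smul]
      exact add_le_add h1 h3
    · rw [add_smul, neg_add]
      exact add_le_add h2 h4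
  zero_mem' := ⟨0, by simp, by simp⟩
  smul_mem' := by
    rintro c a ⟨M, h1, h2⟩
    rcases le_total 0 c with hc | hc
    · refine ⟨c * M, ?_, ?_⟩
      · rw [mul_smul]
        exact smul_le_smul_of_nonneg_left h1 hc
      · rw [mul_smul, ← smul_neg]
        exact smul_le_smul_of_nonneg_left h2 hc
    · have hc' := neg_nonneg.2 hc
      refine ⟨-c * M, ?_, ?_⟩
      · rw [mul_smul, ← neg_smul_neg]
        exact smul_le_smul_of_nonneg_left h2 hc'
      · rw [mul_smul, ← neg_smul]
        exact smul_le_smul_of_nonneg_left h1 hc'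

theorem mem_principalIdeal_of_le {u e : E} {M : ℝ} (h1 : e ≤ M • |u|) (h2 : -e ≤ M • |u|) :
    e ∈ principalIdeal u :=
  ⟨M, h1, h2⟩

theorem sup_mem_principalIdeal {u a b : E} (ha : a ∈ principalIdeal u)
    (hb : b ∈ principalIdeal u) : a ⊔ b ∈ principalIdeal u := by
  obtain ⟨M, h1, h2⟩ := ha
  obtain ⟨N, h3, h4⟩ := hb
  have hM : M • |u| ≤ max M N • |u| :=
    smul_le_smul_of_nonneg_right (le_max_left _ _) (abs_nonneg u)
  have hN : N • |u| ≤ max M N • |u| :=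
    smul_le_smul_of_nonneg_right (le_max_right _ _) (abs_nonneg u)
  exact ⟨max M N, sup_le (h1.trans hM) (h3.trans hN),
    (neg_le_neg le_sup_left).trans (h2.trans hM)⟩

theorem inf_mem_principalIdeal {u a b : E} (ha : a ∈ principalIdeal u)
    (hb : b ∈ principalIdeal u) : a ⊓ b ∈ principalIdeal u := by
  have h := sup_mem_principalIdeal ((principalIdeal u).neg_mem ha) ((principalIdeal u).neg_mem hb)
  rw [← neg_inf] at h
  simpa using (principalIdeal u).neg_mem h

instance (u : E) : Lattice (principalIdeal u) :=
  Subtype.lattice (fun _ _ => sup_mem_principalIdeal)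
    (fun _ _ => inf_mem_principalIdeal)

instance (u : E) : IsOrderedAddMonoid (principalIdeal u) where
  add_le_add_left _ _ h c := add_le_add_left (α := E) h c

instance (u : E) : IsOrderedModule ℝ (principalIdeal u) where
  smul_le_smul_of_nonneg_left _ hc _ _ h := smul_le_smul_of_nonneg_left (β := E) h hc
  smul_le_smul_of_nonneg_right a ha _ _ h :=
    smul_le_smul_of_nonneg_right (β := E) (b := (a : E)) h ha

end Ideal

/-! ### Properties of a Krivine calculus -/

/-- The absolute value of an element of `H_n`. -/
def PosHom.abs {n : ℕ} (f : PosHom n) : PosHom n :=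
  ⟨_, PosHom.sup_mem f (-f)⟩

/-- Substitution of elements of `H_m` into an element of `H_n`. -/
def PosHom.comp {m n : ℕ} (f : PosHom n) (g : Fin n → PosHom m) : PosHom m :=
  ⟨fun s => f.1 fun i => (g i).1 s,
    (PosHom.continuous f).comp (continuous_pi fun i => PosHom.continuous (g i)),
    fun t ht s => by
      rw [← PosHom.map_smul_of_nonneg f ht]
      exact congrArg f.1 (funext fun i => PosHom.map_smul_of_nonneg (g i) ht s)⟩

namespace IsKrivineCalculus

variable {E : Type*} [AddCommGroup E] [Module ℝ E] [Lattice E] {n : ℕ} {x : Fin n → E}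
  {τ : PosHom n →ₗ[ℝ] E}

theorem mono (hτ : IsKrivineCalculus x τ) {f g : PosHom n} (h : ∀ s, f.1 s ≤ g.1 s) :
    τ f ≤ τ g := by
  have hfg : (⟨_, PosHom.sup_mem f g⟩ : PosHom n) = g := by
    ext s
    exact max_eq_right (h s)
  rw [← sup_eq_right, ← hτ.map_sup, hfg]

theorem nonneg (hτ : IsKrivineCalculus x τ) {f : PosHom n} (h : ∀ s, 0 ≤ f.1 s) : 0 ≤ τ f := by
  rw [← map_zero τ]
  exact hτ.mono h

theorem map_abs (hτ : IsKrivineCalculus x τ) (f : PosHom n) : τ (PosHom.abs f) = |τ f| := by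
  rw [PosHom.abs, hτ.map_sup, map_neg]
  rfl

end IsKrivineCalculus

/-! ### Norm and order in a normed lattice -/

theorem norm_le_norm_of_nonneg_of_le {E : Type*} [NormedAddCommGroup E] [Lattice E]
    [IsOrderedAddMonoid E] [HasSolidNorm E] {a b : E} (ha : 0 ≤ a) (h : a ≤ b) : ‖a‖ ≤ ‖b‖ :=
  norm_le_norm_of_abs_le_abs (by rwa [abs_of_nonneg ha, abs_of_nonneg (ha.trans h)])

theorem norm_le_of_le_of_neg_le {E : Type*} [NormedAddCommGroup E] [Lattice E]
    [IsOrderedAddMonoid E] [HasSolidNorm E] {a b : E} (h : a ≤ b) (h' : -a ≤ b) : ‖a‖ ≤ ‖b‖ := by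
  rw [← norm_abs_eq_norm a]
  exact norm_le_norm_of_nonneg_of_le (abs_nonneg a) (sup_le h h')

theorem nonpos_of_forall_le_smul {E : Type*} [NormedAddCommGroup E] [NormedSpace ℝ E]
    [Lattice E] [IsOrderedAddMonoid E] [HasSolidNorm E] {a u : E}
    (h : ∀ ε : ℝ, 0 < ε → a ≤ ε • u) : a ≤ 0 := by
  have hlim : Tendsto (fun ε : ℝ => ε • u) (𝓝[>] 0) (𝓝 0) := by
    have : Tendsto (fun ε : ℝ => ε • u) (𝓝 0) (𝓝 ((0 : ℝ) • u)) :=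
      (continuous_id.smul continuous_const).tendsto 0
    rw [zero_smul] at this
    exact this.mono_left nhdsWithin_le_nhds
  exact ge_of_tendsto hlim (eventually_nhdsWithin_of_forall h)

/-! ### Uniqueness and existence of the Krivine calculus -/

section BanachLattice

variable {E : Type*} [NormedAddCommGroup E] [NormedSpace ℝ E] [Lattice E] [IsOrderedAddMonoid E]
  [HasSolidNorm E]

/-- Two calculi agree on a vector sublattice containing the coordinates, which is dense;
monotonicity turns uniform approximation on the sphere into order estimates in `E`. -/
theorem IsKrivineCalculus.eq {x : Fin 2 → E} {τ τ' : PosHom 2 →ₗ[ℝ] E}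
    (hτ : IsKrivineCalculus x τ) (hτ' : IsKrivineCalculus x τ') : τ = τ' := by
  have hle : ∀ {τ τ' : PosHom 2 →ₗ[ℝ] E}, IsKrivineCalculus x τ → IsKrivineCalculus x τ' →
      ∀ f, τ f - τ' f ≤ 0 := by
    intro τ τ' hτ hτ' f
    let D : Submodule ℝ (PosHom 2) := LinearMap.ker (τ - τ')
    refine nonpos_of_forall_le_smul (u := τ (PosHom.norm 2) + τ' (PosHom.norm 2)) fun ε hε => ?_
    obtain ⟨g, hg, hfg⟩ := PosHom.exists_mem_abs_sub_le (D := D) (fun a ha b hb => by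
      have ha' : τ a = τ' a := sub_eq_zero.1 ha
      have hb' : τ b = τ' b := sub_eq_zero.1 hb
      refine sub_eq_zero.2 ?_
      rw [hτ.map_sup, hτ'.map_sup, ha', hb']) (fun i =>
        sub_eq_zero.2 (by rw [hτ.map_coord, hτ'.map_coord])) f hε
    have hg' : τ g = τ' g := sub_eq_zero.1 hg
    have h1 : τ (f - g) ≤ τ (ε • PosHom.norm 2) := hτ.mono fun s => (abs_le'.1 (hfg s)).1
    have h2 : τ' (-(f - g)) ≤ τ' (ε • PosHom.norm 2) :=
      hτ'.mono fun s => (abs_le'.1 (hfg s)).2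
    rw [map_smul] at h1 h2
    rw [smul_add]
    refine le_trans (le_of_eq ?_) (add_le_add h1 h2)
    rw [map_neg, map_sub, map_sub, hg']
    abel
  ext f
  exact le_antisymm (sub_nonpos.1 (hle hτ hτ' f)) (sub_nonpos.1 (hle hτ' hτ f))

/-- The existence of the Krivine calculus. -/
theorem exists_isKrivineCalculus [IsOrderedModule ℝ E] [CompleteSpace E] (x : Fin 2 → E) :
    ∃ τ : PosHom 2 →ₗ[ℝ] E, IsKrivineCalculus x τ := by
  set u : E := |x 0| ⊔ |x 1|
  have hu0 : 0 ≤ u := (abs_nonneg _).trans le_sup_left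
  have hu : |u| = u := abs_of_nonneg hu0
  let V := principalIdeal u
  have huV : u ∈ V := ⟨1, by simp [hu], by simpa [hu] using (neg_nonpos.2 hu0).trans hu0⟩
  have hxu : ∀ i, |x i| ≤ u := by
    intro i
    fin_cases i
    · exact le_sup_left
    · exact le_sup_right
  have hxV : ∀ i, x i ∈ V := fun i =>
    ⟨1, by simpa [hu] using (le_abs_self _).trans (hxu i),
      by simpa [hu] using (neg_le_abs _).trans (hxu i)⟩
  let U : V := ⟨u, huV⟩
  let X : Fin 2 → V := fun i => ⟨x i, hxV i⟩
  have hU0 : 0 ≤ U := hu0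
  have hUX : U = (X 0 ⊔ -X 0) ⊔ (X 1 ⊔ -X 1) := rfl
  let Φ : Set (V →ₗ[ℝ] ℝ) := {φ | ∀ b c, φ (b ⊔ c) = φ b ⊔ φ c}
  -- Errors of size `ε * ‖s‖` for functions thus become errors `ε • U` in the ideal.
  have hΦu : ∀ φ ∈ Φ, φ U = ‖fun i => φ (X i)‖ := by
    intro φ hφ
    rw [norm_fin_two, hUX, hφ, hφ, hφ, map_neg, map_neg]
    rfl
  have hsep : ∀ a : V, (∀ φ ∈ Φ, φ a ≤ 0) → a ≤ 0 := by
    intro a ha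
    refine nonpos_of_forall_latticeHom (u := U) hU0 ?_ ?_ ha
    · rintro ⟨a, M, hM, -⟩
      refine ⟨M, ?_⟩
      rw [hu] at hM
      exact hM
    · intro a ha
      exact nonpos_of_forall_le_smul (E := E) (a := (a : E)) (u := u) ha
  have hsep' : ∀ {a b : V}, (∀ φ ∈ Φ, φ a ≤ φ b) → a ≤ b := by
    intro a b h
    refine sub_nonpos.1 (hsep _ fun φ hφ => ?_)
    rw [map_sub]
    exact sub_nonpos.2 (h φ hφ)
  have hsep_eq : ∀ {a b : V}, (∀ φ ∈ Φ, φ a = φ b) → a = b := fun h =>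
    le_antisymm (hsep' fun φ hφ => (h φ hφ).le) (hsep' fun φ hφ => (h φ hφ).ge)
  have hmono : ∀ φ ∈ Φ, ∀ {a b : V}, a ≤ b → φ a ≤ φ b := by
    intro φ hφ a b h
    rw [← sup_eq_right.2 h, hφ]
    exact le_sup_left
  -- `R f e` says that `e` is `f(x)` as seen by every lattice homomorphism; by separation there is
  -- at most one such `e`.
  let R : PosHom 2 → V → Prop := fun f e => ∀ φ ∈ Φ, φ e = f.1 fun i => φ (X i)
  have hRcoord : ∀ i, R (PosHom.coord i) (X i) := fun i φ hφ => rfl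
  have hRadd : ∀ {f g a b}, R f a → R g b → R (f + g) (a + b) := by
    intro f g a b ha hb φ hφ
    rw [map_add, ha φ hφ, hb φ hφ]
    rfl
  have hRsmul : ∀ (c : ℝ) {f a}, R f a → R (c • f) (c • a) := by
    intro c f a ha φ hφ
    rw [map_smul, ha φ hφ]
    rfl
  have hRsup : ∀ {f g a b}, R f a → R g b → R ⟨_, PosHom.sup_mem f g⟩ (a ⊔ b) := by
    intro f g a b ha hb φ hφ
    rw [hφ, ha φ hφ, hb φ hφ]
    rfl
  let D : Submodule ℝ (PosHom 2) :=
    { carrier := {f | ∃ e, R f e}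
      add_mem' := fun ⟨a, ha⟩ ⟨b, hb⟩ => ⟨a + b, hRadd ha hb⟩
      zero_mem' := ⟨0, fun φ _ => map_zero φ⟩
      smul_mem' := fun c _ ⟨a, ha⟩ => ⟨c • a, hRsmul c ha⟩ }
  have hex : ∀ f, ∃ e, R f e := by
    intro f
    let δ : ℕ → ℝ := fun k => 1 / ((k : ℝ) + 1)
    have hδ : ∀ k, 0 < δ k := fun k => Nat.one_div_pos_of_nat
    have hδa : ∀ {k l}, k ≤ l → δ l ≤ δ k := fun h => Nat.one_div_le_one_div h
    have hδlim : Tendsto δ atTop (𝓝 0) := tendsto_one_div_add_atTop_nhds_zero_nat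
    have happ := fun k => PosHom.exists_mem_abs_sub_le (D := D)
      (fun a ⟨e, he⟩ b ⟨e', he'⟩ => ⟨e ⊔ e', hRsup he he'⟩)
      (fun i => ⟨X i, hRcoord i⟩) f (hδ k)
    choose g hgD hg using happ
    choose e he using hgD
    have hclose : ∀ k, ∀ φ ∈ Φ, |f.1 (fun i => φ (X i)) - φ (e k)| ≤ δ k * φ U := by
      intro k φ hφ
      rw [he k φ hφ, hΦu φ hφ]
      exact hg k _
    have hdist : ∀ {N k l}, N ≤ k → N ≤ l → e k - e l ≤ (2 * δ N) • U := by
      intro N k l hk hl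
      refine hsep' fun φ hφ => ?_
      have hφU : 0 ≤ φ U := by
        rw [hΦu φ hφ]
        exact norm_nonneg _
      have h1 := (abs_le'.1 (hclose k φ hφ)).2
      have h2 := (abs_le'.1 (hclose l φ hφ)).1
      have h3 := mul_le_mul_of_nonneg_right (hδa hk) hφU
      have h4 := mul_le_mul_of_nonneg_right (hδa hl) hφU
      rw [map_sub, map_smul, smul_eq_mul]
      linarith
    have hcauchy : CauchySeq fun k => (e k : E) := by
      refine cauchySeq_of_le_tendsto_0 (fun N => 2 * δ N * ‖u‖) (fun k l N hk hl => ?_) ?_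
      · rw [dist_eq_norm]
        refine (norm_le_of_le_of_neg_le (b := (2 * δ N) • u) (hdist hk hl) ?_).trans ?_
        · change -((e k : E) - e l) ≤ (2 * δ N) • u
          rw [neg_sub]
          exact hdist hl hk
        · rw [norm_smul, Real.norm_of_nonneg (by linarith [hδ N])]
      · simpa using (hδlim.const_mul 2).mul_const ‖u‖
    obtain ⟨a, ha⟩ := cauchySeq_tendsto_of_complete hcauchy
    have ha1 : ∀ k, a - e k ≤ (2 * δ k) • u := fun k =>
      le_of_tendsto (ha.sub_const _) (eventually_atTop.2 ⟨k, fun l hl => hdist hl le_rfl⟩)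
    have ha2 : ∀ k, e k - a ≤ (2 * δ k) • u := fun k =>
      le_of_tendsto (ha.const_sub _) (eventually_atTop.2 ⟨k, fun l hl => hdist le_rfl hl⟩)
    -- The limit is taken in `E`, since the ideal need not be closed; the order bounds put it back
    -- into `V`.
    have haV : a ∈ V := by
      have h : a - e 0 ∈ V := mem_principalIdeal_of_le (M := 2 * δ 0) (by rw [hu]; exact ha1 0)
        (by rw [hu, neg_sub]; exact ha2 0)
      simpa using V.add_mem h (e 0).2
    refine ⟨⟨a, haV⟩, fun φ hφ => ?_⟩
    have hbound : ∀ k, |φ ⟨a, haV⟩ - f.1 fun i => φ (X i)| ≤ δ k * (3 * φ U) := by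
      intro k
      have h1 : φ (⟨a, haV⟩ - e k) ≤ φ ((2 * δ k) • U) := hmono φ hφ (ha1 k)
      have h2 : φ (e k - ⟨a, haV⟩) ≤ φ ((2 * δ k) • U) := hmono φ hφ (ha2 k)
      rw [map_sub, map_smul, smul_eq_mul] at h1 h2
      have h3 := abs_le'.1 (hclose k φ hφ)
      rw [abs_le']
      constructor <;> linarith [h3.1, h3.2]
    have hlim : Tendsto (fun k => δ k * (3 * φ U)) atTop (𝓝 0) := by
      simpa using hδlim.mul_const (3 * φ U)
    exact sub_eq_zero.1 (abs_nonpos_iff.1 (ge_of_tendsto' hlim hbound))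
  choose T hT using hex
  have hTeq : ∀ {f e}, R f e → T f = e := fun h => hsep_eq fun φ hφ =>
    (hT _ φ hφ).trans (h φ hφ).symm
  let τ : PosHom 2 →ₗ[ℝ] V :=
    { toFun := T
      map_add' := fun f g => hTeq (hRadd (hT f) (hT g))
      map_smul' := fun c f => hTeq (hRsmul c (hT f)) }
  exact ⟨V.subtype ∘ₗ τ, fun i => congrArg Subtype.val (hTeq (hRcoord i)),
    fun f g => congrArg Subtype.val (hTeq (hRsup (hT f) (hT g)))⟩

theorem IsKrivineCalculus.krivine_eq {x : Fin 2 → E} {τ : PosHom 2 →ₗ[ℝ] E}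
    (hτ : IsKrivineCalculus x τ) (f : PosHom 2) : krivine x f = τ f := by
  have h : ∃ τ : PosHom 2 →ₗ[ℝ] E, IsKrivineCalculus x τ := ⟨τ, hτ⟩
  rw [krivine, dif_pos h, h.choose_spec.eq hτ]

/-- Substitution in the Krivine calculus. -/
theorem IsKrivineCalculus.krivine_comp {x : Fin 2 → E} {τ : PosHom 2 →ₗ[ℝ] E}
    (hτ : IsKrivineCalculus x τ) (g : Fin 2 → PosHom 2) (f : PosHom 2) :
    krivine (fun i => τ (g i)) f = τ (PosHom.comp f g) := by
  -- Substitution followed by `τ` is again a calculus, for the substituted elements, so uniqueness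
  -- identifies it.
  let σ : PosHom 2 →ₗ[ℝ] PosHom 2 :=
    { toFun := fun f => PosHom.comp f g
      map_add' := fun _ _ => rfl
      map_smul' := fun _ _ => rfl }
  have hσ : IsKrivineCalculus (fun i => τ (g i)) (τ ∘ₗ σ) :=
    ⟨fun i => rfl, fun a b => hτ.map_sup (σ a) (σ b)⟩
  rw [hσ.krivine_eq]
  rfl

end BanachLattice

end BanachLattice

namespace BanachLattice

/-! ### Signed powers -/

theorem signedPow_neg (r t : ℝ) : signedPow r (-t) = -signedPow r t := by
  simp [signedPow, Left.sign_neg]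

theorem abs_signedPow {r : ℝ} (hr : 0 < r) (t : ℝ) : |signedPow r t| = |t| ^ r := by
  rcases le_total 0 t with ht | ht
  · rw [signedPow_of_nonneg hr ht, abs_of_nonneg ht, abs_of_nonneg (Real.rpow_nonneg ht r)]
  · rw [signedPow_of_nonpos hr ht, abs_of_nonpos ht, abs_neg,
      abs_of_nonneg (Real.rpow_nonneg (neg_nonneg.2 ht) r)]

theorem signedPow_one_div_signedPow {r : ℝ} (hr : 0 < r) (t : ℝ) :
    signedPow (1 / r) (signedPow r t) = t := by
  have h : ∀ t, 0 ≤ t → signedPow (1 / r) (signedPow r t) = t := fun t ht => by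
    rw [signedPow_of_nonneg hr ht,
      signedPow_of_nonneg (one_div_pos.2 hr) (Real.rpow_nonneg ht r), one_div,
      Real.rpow_rpow_inv ht hr.ne']
  rcases le_total 0 t with ht | ht
  · exact h t ht
  · have := h (-t) (neg_nonneg.2 ht)
    rwa [signedPow_neg, signedPow_neg, neg_inj] at this

theorem signedPow_signedPow_one_div {r : ℝ} (hr : 0 < r) (t : ℝ) :
    signedPow r (signedPow (1 / r) t) = t := by
  have h := signedPow_one_div_signedPow (one_div_pos.2 hr) t
  rwa [one_div_one_div] at h

theorem signedPow_neg_one (r : ℝ) : signedPow r (-1) = -1 := by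
  simp [signedPow]

theorem abs_rpow_le_average {q : ℝ} (hq : 1 < q) (a b : ℝ) :
    |a| ^ q ≤ (|a + b| ^ q + |a - b| ^ q) / 2 := by
  have h1 : |a| ≤ (|a + b| + |a - b|) / 2 := by
    have := abs_add_le (a + b) (a - b)
    rw [add_add_sub_cancel, ← two_mul, abs_mul, abs_two] at this
    linarith
  have h2 := (convexOn_rpow hq.le).2 (abs_nonneg (a + b)) (abs_nonneg (a - b))
    (show (0 : ℝ) ≤ 1 / 2 by norm_num) (show (0 : ℝ) ≤ 1 / 2 by norm_num) (by norm_num)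
  simp only [smul_eq_mul] at h2
  calc |a| ^ q ≤ (1 / 2 * |a + b| + 1 / 2 * |a - b|) ^ q :=
        Real.rpow_le_rpow (abs_nonneg a) (by linarith) (by linarith)
    _ ≤ _ := by linarith

/-- If `|a + b| ≠ |a - b|`, strict convexity applies. Otherwise `a * b = 0`, so `a = 0` and the
right side is `|b| ^ q > 0`. -/
theorem abs_rpow_lt_average {q : ℝ} (hq : 1 < q) (a : ℝ) {b : ℝ} (hb : b ≠ 0) :
    |a| ^ q < (|a + b| ^ q + |a - b| ^ q) / 2 := by
  by_cases hab : |a + b| = |a - b|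
  · have ha : a = 0 := by
      have h := (sq_eq_sq_iff_abs_eq_abs _ _).2 hab
      have : a * b = 0 := by linarith
      exact (mul_eq_zero.1 this).resolve_right hb
    have := Real.rpow_pos_of_pos (abs_pos.2 hb) q
    subst ha
    rw [abs_zero, Real.zero_rpow (by linarith), zero_add, zero_sub, abs_neg]
    linarith
  have h1 : |a| ≤ (|a + b| + |a - b|) / 2 := by
    have := abs_add_le (a + b) (a - b)
    rw [add_add_sub_cancel, ← two_mul, abs_mul, abs_two] at this
    linarith
  have h2 := (strictConvexOn_rpow hq).2 (abs_nonneg (a + b)) (abs_nonneg (a - b)) hab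
    (show (0 : ℝ) < 1 / 2 by norm_num) (show (0 : ℝ) < 1 / 2 by norm_num) (by norm_num)
  simp only [smul_eq_mul] at h2
  calc |a| ^ q ≤ (1 / 2 * |a + b| + 1 / 2 * |a - b|) ^ q :=
        Real.rpow_le_rpow (abs_nonneg a) (by linarith) (by linarith)
    _ < _ := by linarith

/-! ### Operations of the `p`-convexification through the calculus -/

namespace PosHom

/-- The sum of two elements of `H_2` in the `p`-convexification. -/
noncomputable def powerAdd (p : ℝ) (hp : 0 < p) (f g : PosHom 2) : PosHom 2 :=
  comp (powerSum p hp) ![f, g]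

theorem powerAdd_apply (p : ℝ) (hp : 0 < p) (f g : PosHom 2) (s : Fin 2 → ℝ) :
    (powerAdd p hp f g).1 s =
      signedPow p (signedPow (1 / p) (f.1 s) + signedPow (1 / p) (g.1 s)) :=
  rfl

theorem powerAdd_smul (p : ℝ) (hp : 0 < p) {c : ℝ} (hc : 0 ≤ c) (f g : PosHom 2) :
    powerAdd p hp (c • f) (c • g) = c • powerAdd p hp f g := by
  ext s
  change (powerSum p hp).1 (fun i => (![c • f, c • g] i).1 s) =
    c * (powerSum p hp).1 (fun i => (![f, g] i).1 s)
  rw [← map_smul_of_nonneg _ hc]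
  refine congrArg (powerSum p hp).1 (funext fun i => ?_)
  fin_cases i <;> rfl

/-- The midpoint of two elements of `H_2` in the `p`-convexification. -/
noncomputable def powerMean (p : ℝ) (hp : 0 < p) (f g : PosHom 2) : PosHom 2 :=
  ((1 / 2 : ℝ) ^ p) • powerAdd p hp f g

theorem powerMean_apply (p : ℝ) (hp : 0 < p) (f g : PosHom 2) (s : Fin 2 → ℝ) :
    (powerMean p hp f g).1 s =
      signedPow p (1 / 2 * (signedPow (1 / p) (f.1 s) + signedPow (1 / p) (g.1 s))) := by
  rw [signedPow_mul hp (by norm_num)]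
  rfl

theorem neg_apply {n : ℕ} (f : PosHom n) (s : Fin n → ℝ) : (-f).1 s = -f.1 s := rfl

theorem powerAdd_powerMean (p : ℝ) (hp : 0 < p) (f g : PosHom 2) :
    powerAdd p hp (powerMean p hp f g) (powerMean p hp f (-g)) = f := by
  ext s
  rw [powerAdd_apply, powerMean_apply, powerMean_apply, signedPow_one_div_signedPow hp,
    signedPow_one_div_signedPow hp, neg_apply, signedPow_neg,
    ← mul_add, add_add_add_comm, add_neg_cancel, add_zero, ← two_mul, ← mul_assoc,
    one_div_mul_cancel two_ne_zero, one_mul, signedPow_signedPow_one_div hp]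

theorem powerAdd_neg_powerMean (p : ℝ) (hp : 0 < p) (f g : PosHom 2) :
    powerAdd p hp (powerMean p hp f g) (-powerMean p hp f (-g)) = g := by
  ext s
  rw [powerAdd_apply, neg_apply, signedPow_neg, powerMean_apply, powerMean_apply,
    signedPow_one_div_signedPow hp, signedPow_one_div_signedPow hp, neg_apply, signedPow_neg,
    show ∀ a b : ℝ, 1 / 2 * (a + b) + -(1 / 2 * (a + -b)) = b by intros; ring,
    signedPow_signedPow_one_div hp]

end PosHom

theorem PConvexification.norm_mk {E : Type*} [NormedAddCommGroup E] {p : ℝ} {hp : 1 < p} (a : E) :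
    ‖(⟨a⟩ : PConvexification E p hp)‖ = ‖a‖ ^ (1 / p) :=
  rfl

section Calculus

variable {E : Type*} [NormedAddCommGroup E] [NormedSpace ℝ E] [Lattice E] [IsOrderedAddMonoid E]
  [HasSolidNorm E] {p : ℝ} {hp : 1 < p} {x : Fin 2 → E} {τ : PosHom 2 →ₗ[ℝ] E}

/-- Reduces addition in `E^{(p)}` to pointwise computation with functions, as long as all the
elements come from one calculus. -/
theorem IsKrivineCalculus.val_add (hτ : IsKrivineCalculus x τ) (f g : PosHom 2) :
    ((⟨τ f⟩ + ⟨τ g⟩ : PConvexification E p hp)).val =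
      τ (PosHom.powerAdd p (zero_lt_one.trans hp) f g) := by
  rw [PosHom.powerAdd, ← hτ.krivine_comp]
  refine congrArg (fun v => krivine v (powerSum p (zero_lt_one.trans hp))) (funext fun i => ?_)
  fin_cases i <;> rfl

theorem IsKrivineCalculus.val_sub (hτ : IsKrivineCalculus x τ) (f g : PosHom 2) :
    ((⟨τ f⟩ - ⟨τ g⟩ : PConvexification E p hp)).val =
      τ (PosHom.powerAdd p (zero_lt_one.trans hp) f (-g)) := by
  have h : ((-1 : ℝ) • ⟨τ g⟩ : PConvexification E p hp) = ⟨τ (-g)⟩ := by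
    ext
    change signedPow p (-1) • τ g = _
    rw [signedPow_neg_one, neg_one_smul, map_neg]
  rw [← hτ.val_add, ← h]
  rfl

/-! ### The main theorem -/

theorem uniformlyMonotone_iff [IsOrderedModule ℝ E] [CompleteSpace E] : UniformlyMonotone E ↔
    ∀ ε : ℝ, 0 < ε → ∃ δ : ℝ, 0 < δ ∧ ∀ x y : E, ‖x‖ = 1 → ε ≤ ‖y‖ → 1 + δ ≤ ‖|x| + |y|‖ := by
  have hval : ∀ {x y : E} {τ : PosHom 2 →ₗ[ℝ] E}, IsKrivineCalculus ![x, y] τ →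
      τ (PosHom.abs (PosHom.coord 0) + PosHom.abs (PosHom.coord 1)) = |x| + |y| := by
    intro x y τ hτ
    rw [map_add, hτ.map_abs, hτ.map_abs, hτ.map_coord, hτ.map_coord]
    rfl
  constructor
  · rintro ⟨p, hp, h⟩ ε hε
    obtain ⟨δ, hδ, h⟩ := h ε hε
    refine ⟨δ, hδ, fun x y hx hy => ?_⟩
    obtain ⟨τ, hτ⟩ := exists_isKrivineCalculus ![x, y]
    have h1 := h x y hx hy
    rw [hτ.krivine_eq] at h1
    have h2 : ‖τ (lpSum p (zero_lt_one.trans_le hp))‖ ≤ ‖|x| + |y|‖ := by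
      rw [← hval hτ]
      refine norm_le_norm_of_nonneg_of_le (hτ.nonneg fun s => ?_) (hτ.mono fun s => ?_)
      · exact Real.rpow_nonneg (add_nonneg (Real.rpow_nonneg (abs_nonneg _) _)
          (Real.rpow_nonneg (abs_nonneg _) _)) _
      · exact Real.rpow_add_rpow_le_add (abs_nonneg _) (abs_nonneg _) hp
    linarith
  · intro h
    refine ⟨1, le_rfl, fun ε hε => ?_⟩
    obtain ⟨δ, hδ, h⟩ := h ε hε
    refine ⟨δ, hδ, fun x y hx hy => ?_⟩
    obtain ⟨τ, hτ⟩ := exists_isKrivineCalculus ![x, y]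
    have h1 := h x y hx hy
    have h2 : lpSum 1 (zero_lt_one.trans_le le_rfl) =
        PosHom.abs (PosHom.coord 0) + PosHom.abs (PosHom.coord 1) := by
      ext s
      change (|s 0| ^ (1 : ℝ) + |s 1| ^ (1 : ℝ)) ^ (1 / (1 : ℝ)) = |s 0| + |s 1|
      simp
    rw [hτ.krivine_eq, h2, hval hτ]
    linarith

/-- Passing to norms in `c|x 1| ≤ F + cη|x 0|` gives the bound. The term with `η` is there because
the functions `F` in use can vanish faster than `|s 1|` near the axis `s 1 = 0`, so that `c|s 1| ≤
F` can fail for every `c > 0`. -/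
theorem mul_norm_le_of_forall_mul_le {c η ε : ℝ} (hc : 0 < c) (hη : 0 ≤ η)
    (hτ : IsKrivineCalculus x τ) {F : PosHom 2} (h : ∀ s, c * (|s 1| - η * |s 0|) ≤ F.1 s)
    (hx : ‖x 0‖ = 1) (hy : ε ≤ ‖x 1‖) : c * (ε - η) ≤ ‖τ F‖ := by
  have h1 : τ ((c : ℝ) • PosHom.abs (PosHom.coord 1)) ≤
      τ (F + (c * η) • PosHom.abs (PosHom.coord 0)) := hτ.mono fun s => by
    change c * |s 1| ≤ F.1 s + c * η * |s 0|
    linarith [h s]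
  have h0 : 0 ≤ τ ((c : ℝ) • PosHom.abs (PosHom.coord 1)) :=
    hτ.nonneg fun s => mul_nonneg hc.le (abs_nonneg _)
  have h2 := norm_le_norm_of_nonneg_of_le h0 h1
  rw [map_add, map_smul, map_smul, hτ.map_abs, hτ.map_abs, hτ.map_coord, hτ.map_coord,
    norm_smul, norm_abs_eq_norm, Real.norm_of_nonneg hc.le] at h2
  have h3 := h2.trans (norm_add_le _ _)
  rw [norm_smul, norm_abs_eq_norm, hx, mul_one, Real.norm_of_nonneg (mul_nonneg hc.le hη)] at h3
  have h4 := mul_le_mul_of_nonneg_left hy hc.le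
  linarith

theorem UniformlyMonotone.uniformlyConvex [IsOrderedModule ℝ E] [CompleteSpace E]
    (hE : UniformlyMonotone E) (q : ℝ) (hq : 1 < q) :
    UniformlyConvex (PConvexification E q hq) := by
  have hq0 : 0 < q := zero_lt_one.trans hq
  have hq' : 0 < 1 / q := one_div_pos.2 hq0
  rw [uniformlyMonotone_iff] at hE
  intro ε hε
  have hεq : 0 < ε ^ q := Real.rpow_pos_of_pos hε q
  let A := PosHom.powerAdd q hq0 (PosHom.coord 0) (PosHom.coord 1)
  let B := PosHom.powerAdd q hq0 (PosHom.coord 0) (-PosHom.coord 1)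
  let F : PosHom 2 := (1 / 2 : ℝ) • (PosHom.abs A + PosHom.abs B) - PosHom.abs (PosHom.coord 0)
  -- Here `ε ^ q` is the lower bound for `‖y‖` in `E`; subtracting half of it makes `G` negative
  -- where `F` vanishes and still leaves `ε ^ q / 2` in norm.
  let G : PosHom 2 := PosHom.abs (PosHom.coord 1) - (ε ^ q / 2) • PosHom.abs (PosHom.coord 0)
  have hF : ∀ s, F.1 s = (|signedPow (1 / q) (s 0) + signedPow (1 / q) (s 1)| ^ q +
      |signedPow (1 / q) (s 0) - signedPow (1 / q) (s 1)| ^ q) / 2 -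
      |signedPow (1 / q) (s 0)| ^ q := by
    intro s
    change 1 / 2 * (|signedPow q (signedPow (1 / q) (s 0) + signedPow (1 / q) (s 1))| +
      |signedPow q (signedPow (1 / q) (s 0) + signedPow (1 / q) (-s 1))|) - |s 0| = _
    rw [signedPow_neg, ← sub_eq_add_neg, abs_signedPow hq0, abs_signedPow hq0,
      ← abs_signedPow hq0 (signedPow (1 / q) (s 0)), signedPow_signedPow_one_div hq0]
    ring
  have hF0 : ∀ s, 0 ≤ F.1 s := fun s => by
    rw [hF]
    exact sub_nonneg.2 (abs_rpow_le_average hq _ _)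
  obtain ⟨c, hc, hcF⟩ := PosHom.exists_mul_le F G hF0 (by
    intro s hs hFs
    have hs1 : s 1 = 0 := by
      by_contra hne
      have hb : signedPow (1 / q) (s 1) ≠ 0 := by
        intro h0
        have := signedPow_signedPow_one_div hq0 (s 1)
        rw [h0] at this
        exact hne (by simpa [signedPow] using this.symm)
      rw [hF] at hFs
      linarith [abs_rpow_lt_average hq (signedPow (1 / q) (s 0)) hb]
    have hs0 : s 0 ≠ 0 := by
      intro h0
      exact hs (funext fun i => by fin_cases i <;> assumption)
    change |s 1| - ε ^ q / 2 * |s 0| < 0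
    rw [hs1, abs_zero, zero_sub, neg_lt_zero]
    exact mul_pos (half_pos hεq) (abs_pos.2 hs0))
  obtain ⟨δ, hδ, hmon⟩ := hE (c * (ε ^ q - ε ^ q / 2)) (mul_pos hc (by linarith))
  refine ⟨(1 + δ) ^ (1 / q) - 1, sub_pos.2 (Real.one_lt_rpow (by linarith) hq'), ?_⟩
  rintro ⟨x⟩ ⟨y⟩ hx hy
  rw [PConvexification.norm_mk] at hx hy
  have hx' : ‖x‖ = 1 := by
    have h := Real.rpow_inv_rpow (norm_nonneg x) hq0.ne'
    rw [← one_div, hx, Real.one_rpow] at h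
    exact h.symm
  have hy' : ε ^ q ≤ ‖y‖ := by
    have h := Real.rpow_le_rpow hε.le hy hq0.le
    rwa [one_div, Real.rpow_inv_rpow (norm_nonneg y) hq0.ne'] at h
  obtain ⟨τ, hτ⟩ := exists_isKrivineCalculus ![x, y]
  have hτx : τ (PosHom.coord 0) = x := hτ.map_coord 0
  have hτy : τ (PosHom.coord 1) = y := hτ.map_coord 1
  have hA := hτ.val_add (hp := hq) (PosHom.coord 0) (PosHom.coord 1)
  have hB := hτ.val_sub (hp := hq) (PosHom.coord 0) (PosHom.coord 1)
  rw [hτx, hτy] at hA hB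
  have hw := hmon x (τ F) hx' (mul_norm_le_of_forall_mul_le hc (half_pos hεq).le hτ hcF hx' hy')
  have hsum : |x| + |τ F| = (1 / 2 : ℝ) • (|τ A| + |τ B|) := by
    rw [abs_of_nonneg (hτ.nonneg hF0), map_sub, map_smul, map_add, hτ.map_abs, hτ.map_abs,
      hτ.map_abs, hτx, add_sub_cancel]
  have hmax : 1 + δ ≤ max ‖τ A‖ ‖τ B‖ := by
    rw [hsum, norm_smul] at hw
    have h := norm_add_le |τ A| |τ B|
    rw [norm_abs_eq_norm, norm_abs_eq_norm] at h
    rw [Real.norm_of_nonneg (by norm_num)] at hw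
    linarith [le_max_left ‖τ A‖ ‖τ B‖, le_max_right ‖τ A‖ ‖τ B‖]
  rw [add_sub_cancel]
  have hpow : ∀ {a : ℝ}, 1 + δ ≤ a → (1 + δ) ^ (1 / q) ≤ a ^ (1 / q) := fun h =>
    Real.rpow_le_rpow (by linarith) h hq'.le
  change _ ≤ max (‖(⟨x⟩ + ⟨y⟩ : PConvexification E q hq).val‖ ^ (1 / q))
    (‖(⟨x⟩ - ⟨y⟩ : PConvexification E q hq).val‖ ^ (1 / q))
  rw [hA, hB]
  rcases le_max_iff.1 hmax with h | h
  · exact (hpow h).trans (le_max_left _ _)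
  · exact (hpow h).trans (le_max_right _ _)

theorem UniformlyConvex.uniformlyMonotone [IsOrderedModule ℝ E] [CompleteSpace E] {q : ℝ}
    {hq : 1 < q} (hE : UniformlyConvex (PConvexification E q hq)) : UniformlyMonotone E := by
  have hq0 : 0 < q := zero_lt_one.trans hq
  have hq' : 0 < 1 / q := one_div_pos.2 hq0
  rw [uniformlyMonotone_iff]
  intro ε hε
  let S : PosHom 2 := PosHom.abs (PosHom.coord 0) + PosHom.abs (PosHom.coord 1)
  let A : PosHom 2 := PosHom.abs (PosHom.coord 0)
  let u := PosHom.powerMean q hq0 S A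
  let v := PosHom.powerMean q hq0 S (-A)
  let G : PosHom 2 := PosHom.abs (PosHom.coord 1) - (ε / 2) • PosHom.abs (PosHom.coord 0)
  have hS : ∀ s, S.1 s = |s 0| + |s 1| := fun s => rfl
  have hA : ∀ s, A.1 s = |s 0| := fun s => rfl
  have hA0 : ∀ s, 0 ≤ A.1 s := fun s => abs_nonneg _
  have hAS : ∀ s, A.1 s ≤ S.1 s := fun s => by
    rw [hS, hA]
    linarith [abs_nonneg (s 1)]
  have hroot : ∀ {a b : ℝ}, 0 ≤ a → a ≤ b →
      0 ≤ signedPow (1 / q) a ∧ signedPow (1 / q) a ≤ signedPow (1 / q) b := fun ha hab => by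
    rw [signedPow_of_nonneg hq' ha, signedPow_of_nonneg hq' (ha.trans hab)]
    exact ⟨Real.rpow_nonneg ha _, Real.rpow_le_rpow ha hab hq'.le⟩
  have hpow : ∀ {a b : ℝ}, 0 ≤ a → a ≤ b → signedPow q a ≤ signedPow q b := fun ha hab => by
    rw [signedPow_of_nonneg hq0 ha, signedPow_of_nonneg hq0 (ha.trans hab)]
    exact Real.rpow_le_rpow ha hab hq0.le
  have hAu : ∀ s, A.1 s ≤ u.1 s := fun s => by
    obtain ⟨h1, h2⟩ := hroot (hA0 s) (hAS s)
    rw [PosHom.powerMean_apply]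
    refine le_trans ?_ (hpow h1 (by linarith))
    rw [signedPow_signedPow_one_div hq0]
  have huS : ∀ s, u.1 s ≤ S.1 s := fun s => by
    obtain ⟨h1, h2⟩ := hroot (hA0 s) (hAS s)
    rw [PosHom.powerMean_apply]
    refine (hpow (by linarith) (show _ ≤ signedPow (1 / q) (S.1 s) by linarith)).trans ?_
    rw [signedPow_signedPow_one_div hq0]
  have hv : ∀ s, v.1 s =
      (1 / 2 * (signedPow (1 / q) (S.1 s) - signedPow (1 / q) (A.1 s))) ^ q := fun s => by
    obtain ⟨h1, h2⟩ := hroot (hA0 s) (hAS s)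
    rw [PosHom.powerMean_apply, PosHom.neg_apply, signedPow_neg, ← sub_eq_add_neg,
      signedPow_of_nonneg hq0 (by linarith)]
  have hbase : ∀ s, 0 ≤ 1 / 2 * (signedPow (1 / q) (S.1 s) - signedPow (1 / q) (A.1 s)) :=
    fun s => by linarith [(hroot (hA0 s) (hAS s)).2]
  have hv0 : ∀ s, 0 ≤ v.1 s := fun s => by
    rw [hv]
    exact Real.rpow_nonneg (hbase s) q
  obtain ⟨c, hc, hcv⟩ := PosHom.exists_mul_le v G hv0 (by
    intro s hs hvs
    rw [hv, Real.rpow_eq_zero (hbase s) hq0.ne'] at hvs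
    have hs1 : s 1 = 0 := by
      have h : signedPow (1 / q) (S.1 s) = signedPow (1 / q) (A.1 s) := by linarith
      have h' := congrArg (signedPow q) h
      rw [signedPow_signedPow_one_div hq0, signedPow_signedPow_one_div hq0, hS, hA] at h'
      exact abs_eq_zero.1 (by linarith)
    have hs0 : s 0 ≠ 0 := by
      intro h0
      exact hs (funext fun i => by fin_cases i <;> assumption)
    change |s 1| - ε / 2 * |s 0| < 0
    rw [hs1, abs_zero, zero_sub, neg_lt_zero]
    exact mul_pos (half_pos hε) (abs_pos.2 hs0))
  -- A lower bound for `‖τ v‖ / N`: the division by `2` reflects `N ≤ 2`, which the cap `min δ 1`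
  -- below secures.
  have hcε : 0 < c * (ε - ε / 2) / 2 := half_pos (mul_pos hc (by linarith))
  obtain ⟨δ, hδ, hconv⟩ := hE ((c * (ε - ε / 2) / 2) ^ (1 / q)) (Real.rpow_pos_of_pos hcε _)
  refine ⟨min δ 1, lt_min hδ one_pos, fun x y hx hy => ?_⟩
  by_contra! hlt
  obtain ⟨τ, hτ⟩ := exists_isKrivineCalculus ![x, y]
  have hτA : τ A = |x| := (hτ.map_abs _).trans (congrArg _ (hτ.map_coord 0))
  have hτS : τ S = |x| + |y| := by
    rw [map_add, hτA, hτ.map_abs, hτ.map_coord]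
    rfl
  have hτA1 : ‖τ A‖ = 1 := by rw [hτA, norm_abs_eq_norm, hx]
  rw [← hτS] at hlt
  set N := ‖τ u‖
  have hN1 : 1 ≤ N := by
    rw [← hτA1]
    exact norm_le_norm_of_nonneg_of_le (hτ.nonneg hA0) (hτ.mono hAu)
  have hN0 : 0 < N := zero_lt_one.trans_le hN1
  have hNS : N ≤ ‖τ S‖ :=
    norm_le_norm_of_nonneg_of_le (hτ.nonneg fun s => (hA0 s).trans (hAu s)) (hτ.mono huS)
  have hN2 : N ≤ 2 := by linarith [min_le_right δ 1]
  have hnorm : ∀ f, ‖τ (N⁻¹ • f)‖ = N⁻¹ * ‖τ f‖ := fun f => by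
    rw [map_smul, norm_smul, norm_inv, Real.norm_of_nonneg hN0.le]
  have hτv : c * (ε - ε / 2) ≤ ‖τ v‖ :=
    mul_norm_le_of_forall_mul_le hc (half_pos hε).le hτ hcv hx hy
  have key := hconv ⟨τ (N⁻¹ • u)⟩ ⟨τ (N⁻¹ • v)⟩
    (by rw [PConvexification.norm_mk, hnorm, inv_mul_cancel₀ hN0.ne', Real.one_rpow])
    (by
      rw [PConvexification.norm_mk, hnorm]
      refine Real.rpow_le_rpow hcε.le ?_ hq'.le
      rw [inv_mul_eq_div]
      exact div_le_div₀ (norm_nonneg _) hτv hN0 hN2)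
  change _ ≤ max (‖(⟨τ (N⁻¹ • u)⟩ + ⟨τ (N⁻¹ • v)⟩ : PConvexification E q hq).val‖ ^ (1 / q))
    (‖(⟨τ (N⁻¹ • u)⟩ - ⟨τ (N⁻¹ • v)⟩ : PConvexification E q hq).val‖ ^ (1 / q)) at key
  have hneg : -(N⁻¹ • v) = N⁻¹ • -v := by
    ext s
    exact (mul_neg N⁻¹ (v.1 s)).symm
  have huv : PosHom.powerAdd q hq0 u v = S := PosHom.powerAdd_powerMean q hq0 S A
  have huv' : PosHom.powerAdd q hq0 u (-v) = A := PosHom.powerAdd_neg_powerMean q hq0 S A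
  rw [hτ.val_add, hτ.val_sub, hneg, PosHom.powerAdd_smul _ _ (inv_nonneg.2 hN0.le),
    PosHom.powerAdd_smul _ _ (inv_nonneg.2 hN0.le), huv, huv', hnorm, hnorm] at key
  have hS1 : 1 ≤ ‖τ S‖ := hN1.trans hNS
  -- Since `‖τ S‖ ≥ 1`, neither the normalisation nor the root can lift a norm above `‖τ S‖`; so
  -- `key` yields `1 + δ ≤ ‖τ S‖`.
  have hbound : ∀ f, ‖τ f‖ ≤ ‖τ S‖ → (N⁻¹ * ‖τ f‖) ^ (1 / q) ≤ ‖τ S‖ := fun f hf => by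
    have h1 : N⁻¹ * ‖τ f‖ ≤ ‖τ S‖ :=
      (mul_le_of_le_one_left (norm_nonneg _) (inv_le_one_of_one_le₀ hN1)).trans hf
    refine (Real.rpow_le_rpow (mul_nonneg (inv_nonneg.2 hN0.le) (norm_nonneg _)) h1
      hq'.le).trans ?_
    exact Real.rpow_le_self_of_one_le hS1 ((div_le_one hq0).2 hq.le)
  have h := key.trans (max_le (hbound S le_rfl) (hbound A (by rw [hτA1]; exact hS1)))
  linarith [min_le_left δ 1]

end Calculus

end BanachLattice

theorem mainTheorem2 (E : Type*) [NormedAddCommGroup E] [NormedSpace ℝ E] [CompleteSpace E]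
    [Lattice E] [IsOrderedAddMonoid E] [IsOrderedModule ℝ E] [HasSolidNorm E] :
    List.TFAE
      [BanachLattice.UniformlyMonotone E,
        ∀ (p : ℝ) (hp : 1 < p),
          BanachLattice.UniformlyConvex (BanachLattice.PConvexification E p hp),
        ∃ (p : ℝ) (hp : 1 < p),
          BanachLattice.UniformlyConvex (BanachLattice.PConvexification E p hp)] := by
  tfae_have 1 → 2 := fun h => h.uniformlyConvex
  tfae_have 2 → 3 := fun h => ⟨2, one_lt_two, h 2 one_lt_two⟩
  tfae_have 3 → 1 := fun ⟨_, _, h⟩ => h.uniformlyMonotone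
  tfae_finish
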